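/- Let $\|A\|_1=\mathrm{tr}\sqrt{A^\dagger A}$ be the trace norm. For every $\delta_0<1$ there is a constant $C>0$, depending only on $\delta_0$, such that for all $n$, all $\epsilon>0$ and all $0<\delta\le\delta_0$ there is an integer $m\ge 0$ with $$m\cdot 3^n\;\le\; C\,\frac{10^n\log(1/\delta)}{\epsilon^2}$$ for which the following holds. Given $m\cdot 3^n$ copies of an unknown $n$-qubit state $\rho$, measure, independently, $m$ of them with each $P=P_1\otimes\cdots\otimes P_n\in\{\sigma_X,\sigma_Y,\sigma_Z\}^{\otimes n}$, where measuring $P$ means measuring the observable $P_i$ on the $i$-th qubit for every $i$, and record the outcome strings. (1) From the recorded outcomes alone one can compute a density matrix $\sigma$ such that, for every $\rho$, $\|\rho-\sigma\|_1<\epsilon$ with probability at least $1-\delta$. (2) If $\epsilon\le 2$, then $m\ge 1$ and the following explicit estimator (a matrix that need not be positive semidefinite) also works. For $Q\in\{I,\sigma_X,\sigma_Y,\sigma_Z\}^{\otimes n}$ with $w_Q$ non-identity factors, let $\mu_Q$ be the sum, over all measured copies whose setting $P$ turns into $Q$ when some (possibly none) of its factors are replaced by $I$, of the product of the $\pm1$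 outcomes on the qubits where $Q_i\ne I$; put $$\hat\sigma=\sum_Q \frac{\mu_Q}{m\,3^{\,n-w_Q}\,2^n}\,Q .$$ Then, for every $\rho$, $\mathbb E\,\hat\sigma=\rho$, and $\|\rho-\hat\sigma\|_1<\epsilon$ with probability at least $1-\delta$. -/

import Mathlib

open MeasureTheory
open scoped ComplexOrder

namespace PauliTomography

/-- The three nontrivial single-qubit Pauli observables. -/
inductive PauliAxis
  | X
  | Y
  | Z
  deriving DecidableEq

instance : Fintype PauliAxis where
  elems := {.X, .Y, .Z}
  complete := fun a => by cases a <;> simp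

/-- The `2 × 2` Pauli matrices `σ_X`, `σ_Y`, `σ_Z`. -/
def PauliAxis.toMatrix : PauliAxis → Matrix (Fin 2) (Fin 2) ℂ
  | .X => !![0, 1; 1, 0]
  | .Y => !![0, -Complex.I; Complex.I, 0]
  | .Z => !![1, 0; 0, -1]

/-- The four single-qubit Pauli matrices; `none` stands for the identity. -/
def pauliMatrix : Option PauliAxis → Matrix (Fin 2) (Fin 2) ℂ
  | none => 1
  | some a => a.toMatrix

/-- Labels of the computational basis of `n` qubits; also the `n`-bit outcome strings. -/
abbrev Bits (n : ℕ) : Type := Fin n → Fin 2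

/-- The tensor product `A 0 ⊗ A 1 ⊗ ⋯ ⊗ A (n - 1)` of single-qubit matrices. -/
def tensor {n : ℕ} (A : Fin n → Matrix (Fin 2) (Fin 2) ℂ) : Matrix (Bits n) (Bits n) ℂ :=
  Matrix.of fun s t => ∏ i, A i (s i) (t i)

/-- Mixed states of `n` qubits. -/
structure DensityMatrix (n : ℕ) where
  val : Matrix (Bits n) (Bits n) ℂ
  posSemidef : val.PosSemidef
  trace_eq_one : val.trace = 1

/-- The trace norm `‖A‖₁ = tr √(Aᴴ A)`: the sum of the singular values of `A`, that is, of the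
square roots of the eigenvalues of `Aᴴ A`, with multiplicity. -/
noncomputable def traceNorm {ι : Type*} [Fintype ι] [DecidableEq ι] (A : Matrix ι ι ℂ) : ℝ :=
  ∑ i, Real.sqrt ((Matrix.isHermitian_conjTranspose_mul_self A).eigenvalues i)

/-- The eigenvalue `1` or `-1` that the outcome bit `0` or `1` stands for. -/
def sign (b : Fin 2) : ℤ := (-1) ^ (b : ℕ)

/-- The orthogonal projection `(I + (-1)^b σ_a) / 2` onto the `(-1)^b`-eigenspace of `σ_a`. -/
noncomputable def qubitProj (a : PauliAxis) (b : Fin 2) : Matrix (Fin 2) (Fin 2) ℂ :=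
  (1 / 2 : ℂ) • (1 + (sign b : ℂ) • a.toMatrix)

/-- The projection for the outcome string `s` when qubit `i` is measured with `σ_{P i}`. -/
noncomputable def outcomeProj {n : ℕ} (P : Fin n → PauliAxis) (s : Bits n) :
    Matrix (Bits n) (Bits n) ℂ :=
  tensor fun i => qubitProj (P i) (s i)

/-- Born rule: the probability of the outcome string `s` when `P` is measured on `ρ`. -/
noncomputable def bornProb {n : ℕ} (ρ : DensityMatrix n) (P : Fin n → PauliAxis) (s : Bits n) :
    ℝ :=
  (ρ.val * outcomeProj P s).trace.re

theorem tensor_mul {n : ℕ} (A B : Fin n → Matrix (Fin 2) (Fin 2) ℂ) :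
    tensor A * tensor B = tensor fun i => A i * B i := by
  ext s t
  simp only [tensor, Matrix.mul_apply, Matrix.of_apply, Finset.prod_univ_sum,
    Fintype.piFinset_univ, Finset.prod_mul_distrib]

theorem tensor_conjTranspose {n : ℕ} (A : Fin n → Matrix (Fin 2) (Fin 2) ℂ) :
    (tensor A).conjTranspose = tensor fun i => (A i).conjTranspose := by
  ext s t
  simp [tensor, Matrix.conjTranspose_apply]

theorem qubitProj_mul_self (a : PauliAxis) (b : Fin 2) :
    qubitProj a b * qubitProj a b = qubitProj a b := by
  ext i j
  cases a <;> fin_cases b <;> fin_cases i <;> fin_cases j <;>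
    simp [qubitProj, sign, PauliAxis.toMatrix, Matrix.mul_apply, Fin.sum_univ_two] <;>
    ring_nf <;> simp <;> ring

theorem qubitProj_conjTranspose (a : PauliAxis) (b : Fin 2) :
    (qubitProj a b).conjTranspose = qubitProj a b := by
  ext i j
  cases a <;> fin_cases b <;> fin_cases i <;> fin_cases j <;>
    simp [qubitProj, sign, PauliAxis.toMatrix, Matrix.conjTranspose_apply] <;>
    ring

theorem qubitProj_sum (a : PauliAxis) : ∑ b, qubitProj a b = 1 := by
  ext i j
  cases a <;> fin_cases i <;> fin_cases j <;>
    simp [qubitProj, sign, PauliAxis.toMatrix, Fin.sum_univ_two] <;> norm_num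

theorem outcomeProj_sum {n : ℕ} (P : Fin n → PauliAxis) : ∑ s, outcomeProj P s = 1 := by
  ext u v
  have h : ∀ i, ∑ b, qubitProj (P i) b (u i) (v i)
      = (1 : Matrix (Fin 2) (Fin 2) ℂ) (u i) (v i) := by
    intro i
    rw [← qubitProj_sum (P i), Matrix.sum_apply]
  rw [Matrix.sum_apply]
  simp only [outcomeProj, tensor, Matrix.of_apply]
  rw [← Fintype.piFinset_univ,
    ← Finset.prod_univ_sum (fun _ => Finset.univ) (fun i b => qubitProj (P i) b (u i) (v i))]
  simp only [h, Matrix.one_apply, Finset.prod_ite_zero, Finset.prod_const_one, Finset.mem_univ,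
    true_implies, funext_iff]

theorem bornProb_nonneg {n : ℕ} (ρ : DensityMatrix n) (P : Fin n → PauliAxis) (s : Bits n) :
    0 ≤ bornProb ρ P s := by
  have hm : outcomeProj P s * outcomeProj P s = outcomeProj P s := by
    simp only [outcomeProj, tensor_mul, qubitProj_mul_self]
  have hc : (outcomeProj P s).conjTranspose = outcomeProj P s := by
    simp only [outcomeProj, tensor_conjTranspose, qubitProj_conjTranspose]
  have h : (ρ.val * outcomeProj P s).trace
      = (outcomeProj P s * ρ.val * (outcomeProj P s).conjTranspose).trace := by
    rw [hc, Matrix.trace_mul_comm, Matrix.trace_mul_comm (outcomeProj P s * ρ.val),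
      ← Matrix.mul_assoc, hm]
  have h2 := (ρ.posSemidef.mul_mul_conjTranspose_same (outcomeProj P s)).trace_nonneg
  rw [← h] at h2
  exact (Complex.le_def.mp h2).1

theorem bornProb_sum {n : ℕ} (ρ : DensityMatrix n) (P : Fin n → PauliAxis) :
    ∑ s, bornProb ρ P s = 1 := by
  simp only [bornProb]
  rw [← Complex.re_sum, ← Matrix.trace_sum, ← Matrix.mul_sum, outcomeProj_sum, Matrix.mul_one,
    ρ.trace_eq_one, Complex.one_re]

/-- The distribution of the outcome string when `P` is measured on one copy of `ρ`. -/
noncomputable def outcomePMF {n : ℕ} (ρ : DensityMatrix n) (P : Fin n → PauliAxis) :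
    PMF (Bits n) :=
  PMF.ofFintype (fun s => ENNReal.ofReal (bornProb ρ P s)) (by
    rw [← ENNReal.ofReal_sum_of_nonneg fun s _ => bornProb_nonneg ρ P s, bornProb_sum,
      ENNReal.ofReal_one])

/-- The copies of the state that are used: `m` copies for each of the `3 ^ n` measurement
settings `P`, and each copy is measured once. -/
abbrev Copy (n m : ℕ) : Type := (Fin n → PauliAxis) × Fin m

/-- The complete measurement record: one outcome string for each copy. -/
abbrev Record (n m : ℕ) : Type := Copy n m → Bits n

/-- The law of the record: the copies are measured independently, the copy `(P, j)` with `P`. -/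
noncomputable def recordLaw {n : ℕ} (ρ : DensityMatrix n) (m : ℕ) : Measure (Record n m) :=
  Measure.pi fun c : Copy n m => (outcomePMF ρ c.1).toMeasure

/-- The number of factors of `Q` that are not the identity. -/
def weight {n : ℕ} (Q : Fin n → Option PauliAxis) : ℕ :=
  (Finset.univ.filter fun i => Q i ≠ none).card

/-- `Q` is obtained from `P` by replacing some factors with the identity. -/
def Corresponds {n : ℕ} (Q : Fin n → Option PauliAxis) (P : Fin n → PauliAxis) : Prop :=
  ∀ i, Q i = none ∨ Q i = some (P i)

instance {n : ℕ} (Q : Fin n → Option PauliAxis) : DecidablePred (Corresponds Q) :=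
  fun P => inferInstanceAs (Decidable (∀ i, Q i = none ∨ Q i = some (P i)))

/-- `μ_Q`: the sum of the `±1` samples of `Q` that are read off from all the outcome strings of
the settings `P` to which `Q` corresponds. -/
def sampleSum {n m : ℕ} (x : Record n m) (Q : Fin n → Option PauliAxis) : ℤ :=
  ∑ P with Corresponds Q P, ∑ j, ∏ i with Q i ≠ none, sign (x (P, j) i)

/-- The estimator `∑_Q μ_Q / (m 3^(n - w_Q) 2^n) Q`, with `Q` over all `4 ^ n` Pauli operators. -/
noncomputable def pauliEstimator {n m : ℕ} (x : Record n m) : Matrix (Bits n) (Bits n) ℂ :=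
  ∑ Q : Fin n → Option PauliAxis,
    ((sampleSum x Q : ℂ) / ((m : ℂ) * 3 ^ (n - weight Q) * 2 ^ n)) •
      tensor fun i => pauliMatrix (Q i)

end PauliTomography

open PauliTomography

namespace PauliTomography

/-! Regrouped by copies instead of by Pauli operators, the estimator is `1/m` times a sum of
independent product matrices: an outcome `s` of the setting `P` contributes the tensor product of
the factors `I/6 ± σ/2` (`pauliEstimator_apply`). Averaged over outcomes and summed over settings,
these snapshots give back `ρ`, because on one qubit this is the completeness relation of the Pauli
matrices (`sum_qubitProj_mul_qubitSnapshot`).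

Every snapshot has squared Frobenius norm exactly `(5/9)^n`, so the `m * 3^n` centred contributions
give a squared Frobenius error of order `(5/3)^n / m`. Cauchy–Schwarz over the `2^n` singular values
turns this into a squared trace-norm error of order `(10/3)^n / m`, whence `10^n / ε^2` copies. The
dependence on `δ` comes from a dimension-free tail bound for sums of independent bounded vectors in
a Hilbert space (`sum_prod_norm_ge_le`): the second moment bounds the mean of the norm, and bounded
differences control its fluctuation.

For a genuine state, any density matrix close enough to the estimator will do: `ρ` itself is a
candidate with high probability, so the triangle inequality costs a factor 2. -/

/-! ### Concentration for sums of independent vectors -/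

/-- Averaging over a product of `N + 1` factors, one factor at a time. -/
theorem sum_prod_mul_fin_succ {α M : Type*} [Fintype α] [AddCommMonoid M] [Module ℝ M] {N : ℕ}
    (p : Fin (N + 1) → α → ℝ) (f : (Fin (N + 1) → α) → M) :
    ∑ x, (∏ i, p i (x i)) • f x
      = ∑ a, p 0 a • ∑ y : Fin N → α, (∏ i, p i.succ (y i)) • f (Fin.cons a y) := by
  rw [← (Fin.consEquiv fun _ : Fin (N + 1) => α).sum_comp, Fintype.sum_prod_type]
  refine Finset.sum_congr rfl fun a _ => ?_
  rw [Finset.smul_sum]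
  refine Finset.sum_congr rfl fun y _ => ?_
  simp [Fin.consEquiv, Fin.prod_univ_succ, mul_smul]

theorem sum_prod_eq_one {α ι : Type*} [Fintype α] [Fintype ι] [DecidableEq ι] (p : ι → α → ℝ)
    (hp : ∀ i, ∑ a, p i a = 1) : ∑ x : ι → α, ∏ i, p i (x i) = 1 := by
  rw [← Fintype.piFinset_univ, ← Finset.prod_univ_sum]
  simp [hp]

/-- A weak form of Hoeffding's lemma, by symmetrization. -/
theorem sum_mul_exp_le {α : Type*} [Fintype α] (p : α → ℝ) (hp0 : ∀ a, 0 ≤ p a)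
    (hp1 : ∑ a, p a = 1) (g : α → ℝ) (c : ℝ) (hg : ∀ a b, g a - g b ≤ c) :
    ∑ a, p a * Real.exp (g a) ≤ Real.exp (∑ a, p a * g a + c ^ 2 / 2) := by
  have jensen : Real.exp (-∑ a, p a * g a) ≤ ∑ b, p b * Real.exp (-g b) := by
    have := convexOn_exp.map_sum_le (t := Finset.univ) (w := p) (p := fun b => -g b)
      (fun i _ => hp0 i) hp1 (fun i _ => Set.mem_univ _)
    simpa [smul_eq_mul, Finset.sum_neg_distrib] using this
  -- The second factor is an independent copy. Exchanging `a` and `b` flips the sign of the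
  -- difference, so the exponential may be replaced by its even part.
  have sym : (∑ a, p a * Real.exp (g a)) * ∑ b, p b * Real.exp (-g b)
      = ∑ a, ∑ b, p a * p b * Real.cosh (g a - g b) := by
    have h1 : (∑ a, p a * Real.exp (g a)) * ∑ b, p b * Real.exp (-g b)
        = ∑ a, ∑ b, p a * p b * Real.exp (g a - g b) := by
      rw [Finset.sum_mul_sum]
      refine Finset.sum_congr rfl fun a _ => Finset.sum_congr rfl fun b _ => ?_
      rw [sub_eq_add_neg, Real.exp_add]; ring
    have h2 : ∑ a, ∑ b, p a * p b * Real.exp (g a - g b)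
        = ∑ a, ∑ b, p a * p b * Real.exp (-(g a - g b)) := by
      rw [Finset.sum_comm]
      refine Finset.sum_congr rfl fun a _ => Finset.sum_congr rfl fun b _ => ?_
      rw [neg_sub]; ring
    have h3 : ∑ a, ∑ b, p a * p b * Real.cosh (g a - g b)
        = ((∑ a, ∑ b, p a * p b * Real.exp (g a - g b))
          + ∑ a, ∑ b, p a * p b * Real.exp (-(g a - g b))) / 2 := by
      simp only [Real.cosh_eq, ← Finset.sum_add_distrib, Finset.sum_div]
      refine Finset.sum_congr rfl fun a _ => Finset.sum_congr rfl fun b _ => ?_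
      ring
    rw [h3, ← h2, h1]; ring
  have bound : ∑ a, ∑ b, p a * p b * Real.cosh (g a - g b) ≤ Real.exp (c ^ 2 / 2) := by
    calc ∑ a, ∑ b, p a * p b * Real.cosh (g a - g b)
        ≤ ∑ a, ∑ b, p a * p b * Real.exp (c ^ 2 / 2) := by
          refine Finset.sum_le_sum fun a _ => Finset.sum_le_sum fun b _ => ?_
          refine mul_le_mul_of_nonneg_left ?_ (mul_nonneg (hp0 a) (hp0 b))
          refine (Real.cosh_le_exp_half_sq _).trans (Real.exp_le_exp.2 ?_)
          have : (g a - g b) ^ 2 ≤ c ^ 2 := sq_le_sq' (by linarith [hg b a]) (hg a b)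
          linarith
      _ = Real.exp (c ^ 2 / 2) := by
          simp only [← Finset.sum_mul, ← Finset.mul_sum, hp1, mul_one, one_mul]
  have hpos : 0 ≤ ∑ a, p a * Real.exp (g a) :=
    Finset.sum_nonneg fun a _ => mul_nonneg (hp0 a) (Real.exp_pos _).le
  have key := (mul_le_mul_of_nonneg_left jensen hpos).trans (sym.trans_le bound)
  rw [Real.exp_neg, ← div_eq_mul_inv, div_le_iff₀ (Real.exp_pos _)] at key
  rwa [add_comm, Real.exp_add]

/-- The exponential moment bound behind McDiarmid's bounded differences inequality. -/
theorem sum_prod_mul_exp_le {α : Type*} [Fintype α] (c : ℝ) :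
    ∀ (N : ℕ) (p : Fin N → α → ℝ), (∀ i a, 0 ≤ p i a) → (∀ i, ∑ a, p i a = 1) →
    ∀ f : (Fin N → α) → ℝ, (∀ x i a, f (Function.update x i a) - f x ≤ c) →
    ∑ x, (∏ i, p i (x i)) * Real.exp (f x)
      ≤ Real.exp (∑ x, (∏ i, p i (x i)) * f x + N * c ^ 2 / 2) := by
  intro N
  induction N with
  | zero => intro p _ _ f _; simp
  | succ N ih =>
    intro p hp0 hp1 f hf
    have e1 := sum_prod_mul_fin_succ p fun x => Real.exp (f x)
    have e2 := sum_prod_mul_fin_succ p f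
    simp only [smul_eq_mul] at e1 e2
    rw [e1, e2]
    -- The conditional mean of `f` given the first coordinate. It inherits the bounded difference
    -- `c`, so the one-variable bound applies to it.
    set h : α → ℝ := fun a => ∑ y : Fin N → α, (∏ i, p i.succ (y i)) * f (Fin.cons a y) with hh
    have step : ∀ a, ∑ y : Fin N → α, (∏ i, p i.succ (y i)) * Real.exp (f (Fin.cons a y))
        ≤ Real.exp (h a + N * c ^ 2 / 2) := by
      intro a
      refine ih (fun i => p i.succ) (fun i => hp0 _) (fun i => hp1 _) _ ?_
      intro y i b
      have := hf (Fin.cons a y) i.succ b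
      rwa [← Fin.cons_update] at this
    have hdiff : ∀ a b, h a - h b ≤ c := by
      intro a b
      have : h a - h b
          = ∑ y : Fin N → α, (∏ i, p i.succ (y i)) * (f (Fin.cons a y) - f (Fin.cons b y)) := by
        simp only [hh, mul_sub, Finset.sum_sub_distrib]
      rw [this]
      calc _ ≤ ∑ y : Fin N → α, (∏ i, p i.succ (y i)) * c := by
            refine Finset.sum_le_sum fun y _ =>
              mul_le_mul_of_nonneg_left ?_ (Finset.prod_nonneg fun i _ => hp0 _ _)
            have := hf (Fin.cons b y) 0 a
            rwa [Fin.update_cons_zero] at this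
        _ = c := by
            rw [← Finset.sum_mul, sum_prod_eq_one (fun i : Fin N => p i.succ) fun i => hp1 _,
              one_mul]
    calc _ ≤ ∑ a, p 0 a * Real.exp (h a + N * c ^ 2 / 2) :=
          Finset.sum_le_sum fun a _ => mul_le_mul_of_nonneg_left (step a) (hp0 _ _)
      _ = (∑ a, p 0 a * Real.exp (h a)) * Real.exp (N * c ^ 2 / 2) := by
          rw [Finset.sum_mul]
          refine Finset.sum_congr rfl fun a _ => ?_
          rw [Real.exp_add]; ring
      _ ≤ Real.exp (∑ a, p 0 a * h a + c ^ 2 / 2) * Real.exp (N * c ^ 2 / 2) :=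
          mul_le_mul_of_nonneg_right (sum_mul_exp_le _ (hp0 0) (hp1 0) h c hdiff)
            (Real.exp_pos _).le
      _ = _ := by
          rw [← Real.exp_add]; congr 1; push_cast; ring

/-- Second moment of a sum of independent centred vectors. -/
theorem sum_prod_mul_norm_sq_le {𝕜 E α : Type*} [RCLike 𝕜] [NormedAddCommGroup E]
    [InnerProductSpace 𝕜 E] [Fintype α] (B : ℝ) :
    ∀ (N : ℕ) (p : Fin N → α → ℝ), (∀ i a, 0 ≤ p i a) → (∀ i, ∑ a, p i a = 1) →
    ∀ Z : Fin N → α → E, (∀ i a, ‖Z i a‖ ≤ B) → (∀ i, ∑ a, (p i a : 𝕜) • Z i a = 0) →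
    ∀ v : E, ∑ x : Fin N → α, (∏ i, p i (x i)) * ‖v + ∑ i, Z i (x i)‖ ^ 2
      ≤ ‖v‖ ^ 2 + N * B ^ 2 := by
  intro N
  induction N with
  | zero => intro p _ _ Z _ _ v; simp
  | succ N ih =>
    intro p hp0 hp1 Z hZ hZ0 v
    have e1 := sum_prod_mul_fin_succ p fun x => ‖v + ∑ i, Z i (x i)‖ ^ 2
    simp only [smul_eq_mul] at e1
    rw [e1]
    have step : ∀ a, ∑ y : Fin N → α, (∏ i, p i.succ (y i))
        * ‖v + ∑ i, Z i ((Fin.cons a y : Fin (N + 1) → α) i)‖ ^ 2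
        ≤ ‖v + Z 0 a‖ ^ 2 + N * B ^ 2 := by
      intro a
      -- The arbitrary starting vector in the statement absorbs the summand already drawn.
      have := ih (fun i => p i.succ) (fun i => hp0 _) (fun i => hp1 _) (fun i => Z i.succ)
        (fun i => hZ _) (fun i => hZ0 _) (v + Z 0 a)
      simpa only [Fin.sum_univ_succ, Fin.cons_zero, Fin.cons_succ, add_assoc] using this
    have cross : ∑ a, p 0 a * RCLike.re (inner 𝕜 v (Z 0 a)) = 0 := by
      have : RCLike.re (inner 𝕜 v (∑ a, (p 0 a : 𝕜) • Z 0 a)) = 0 := by rw [hZ0]; simp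
      rw [← this, inner_sum, map_sum]
      refine Finset.sum_congr rfl fun a _ => ?_
      rw [inner_smul_right, RCLike.re_ofReal_mul]
    calc _ ≤ ∑ a, p 0 a * (‖v + Z 0 a‖ ^ 2 + N * B ^ 2) :=
          Finset.sum_le_sum fun a _ => mul_le_mul_of_nonneg_left (step a) (hp0 _ _)
      _ ≤ ∑ a, (p 0 a * (‖v‖ ^ 2 + (N + 1) * B ^ 2)
            + 2 * (p 0 a * RCLike.re (inner 𝕜 v (Z 0 a)))) := by
          refine Finset.sum_le_sum fun a _ => ?_
          rw [norm_add_sq (𝕜 := 𝕜)]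
          have h := pow_le_pow_left₀ (norm_nonneg _) (hZ 0 a) 2
          nlinarith [mul_le_mul_of_nonneg_left h (hp0 0 a)]
      _ = _ := by
          rw [Finset.sum_add_distrib, ← Finset.mul_sum, cross, ← Finset.sum_mul, hp1]
          push_cast; ring

/-- The probability that a sum of `N` independent centred vectors of norm at most `B` is large. -/
theorem sum_prod_norm_ge_le_fin {𝕜 E α : Type*} [RCLike 𝕜] [NormedAddCommGroup E]
    [InnerProductSpace 𝕜 E] [Fintype α] {B : ℝ} {N : ℕ} (hB : 0 < B) (hN : 0 < N)
    (p : Fin N → α → ℝ) (hp0 : ∀ i a, 0 ≤ p i a) (hp1 : ∀ i, ∑ a, p i a = 1)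
    (Z : Fin N → α → E) (hZ : ∀ i a, ‖Z i a‖ ≤ B) (hZ0 : ∀ i, ∑ a, (p i a : 𝕜) • Z i a = 0)
    {t : ℝ} (ht : √N * B ≤ t) :
    ∑ x : Fin N → α with t ≤ ‖∑ i, Z i (x i)‖, ∏ i, p i (x i)
      ≤ Real.exp (-((t - √N * B) ^ 2 / (8 * (N * B ^ 2)))) := by
  set w : (Fin N → α) → ℝ := fun x => ∏ i, p i (x i) with hw
  have w0 : ∀ x, 0 ≤ w x := fun x => Finset.prod_nonneg fun i _ => hp0 _ _
  have w1 : ∑ x, w x = 1 := sum_prod_eq_one p hp1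
  set f : (Fin N → α) → ℝ := fun x => ‖∑ i, Z i (x i)‖ with hfdef
  have mean : ∑ x, w x * f x ≤ √N * B := by
    have h2 : ∑ x, w x * f x ^ 2 ≤ N * B ^ 2 := by
      simpa using sum_prod_mul_norm_sq_le (𝕜 := 𝕜) B N p hp0 hp1 Z hZ hZ0 0
    have h3 : (∑ x, w x * f x) ^ 2 ≤ ∑ x, w x * f x ^ 2 := by
      simpa [smul_eq_mul] using (convexOn_pow 2).map_sum_le (t := Finset.univ) (w := w) (p := f)
        (fun i _ => w0 i) w1 (fun i _ => norm_nonneg _)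
    refine (le_abs_self _).trans (abs_le_of_sq_le_sq ?_ (by positivity))
    rw [mul_pow, Real.sq_sqrt (Nat.cast_nonneg _)]
    exact h3.trans h2
  have diff : ∀ x i a, f (Function.update x i a) - f x ≤ 2 * B := by
    intro x i a
    refine (norm_sub_norm_le _ _).trans ?_
    have : ∑ j, Z j (Function.update x i a j) - ∑ j, Z j (x j) = Z i a - Z i (x i) := by
      rw [← Finset.sum_sub_distrib, Finset.sum_eq_single i]
      · simp
      · intro j _ hj; simp [Function.update_of_ne hj]
      · simp
    rw [this]
    exact (norm_sub_le _ _).trans (by linarith [hZ i a, hZ i (x i)])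
  set V : ℝ := N * B ^ 2 with hV
  have hVpos : 0 < V := by positivity
  -- The minimizer of the Chernoff exponent `2 l² V - l (t - √N B)`.
  set l : ℝ := (t - √N * B) / (4 * V) with hl
  have hl0 : 0 ≤ l := div_nonneg (by linarith) (by positivity)
  have mgf := sum_prod_mul_exp_le (l * (2 * B)) N p hp0 hp1 (fun x => l * f x) (by
    intro x i a
    rw [← mul_sub]
    exact mul_le_mul_of_nonneg_left (diff x i a) hl0)
  have markov : (∑ x with t ≤ f x, w x) * Real.exp (l * t) ≤ ∑ x, w x * Real.exp (l * f x) := by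
    rw [Finset.sum_mul]
    calc _ ≤ ∑ x with t ≤ f x, w x * Real.exp (l * f x) := by
          refine Finset.sum_le_sum fun x hx => mul_le_mul_of_nonneg_left ?_ (w0 x)
          exact Real.exp_le_exp.2
            (mul_le_mul_of_nonneg_left (Finset.mem_filter.1 hx).2 hl0)
      _ ≤ _ := Finset.sum_le_sum_of_subset_of_nonneg (Finset.filter_subset _ _)
          fun x _ _ => mul_nonneg (w0 x) (Real.exp_pos _).le
  have key := markov.trans mgf
  rw [← le_div_iff₀ (Real.exp_pos _), ← Real.exp_sub] at key
  refine key.trans (Real.exp_le_exp.2 ?_)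
  have e : ∑ x, (∏ i, p i (x i)) * (l * f x) = l * ∑ x, w x * f x := by
    rw [Finset.mul_sum]; exact Finset.sum_congr rfl fun x _ => by simp only [hw]; ring
  rw [e]
  have h4 : l * ∑ x, w x * f x ≤ l * (√N * B) := mul_le_mul_of_nonneg_left mean hl0
  have h5 : (N : ℝ) * (l * (2 * B)) ^ 2 / 2 = 2 * l ^ 2 * V := by rw [hV]; ring
  have h6 : l * (t - √N * B) - 2 * l ^ 2 * V = (t - √N * B) ^ 2 / (8 * V) := by
    rw [hl]; field_simp; ring
  rw [h5]; linarith

/-- The inductions need factors numbered by `Fin N`; the bound does not depend on the numbering, so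
it transfers to the index type of the copies. -/
theorem sum_prod_norm_ge_le {𝕜 E α ι : Type*} [RCLike 𝕜] [NormedAddCommGroup E]
    [InnerProductSpace 𝕜 E] [Fintype α] [Fintype ι] [DecidableEq ι] [Nonempty ι] {B : ℝ}
    (hB : 0 < B) (p : ι → α → ℝ) (hp0 : ∀ i a, 0 ≤ p i a) (hp1 : ∀ i, ∑ a, p i a = 1)
    (Z : ι → α → E) (hZ : ∀ i a, ‖Z i a‖ ≤ B) (hZ0 : ∀ i, ∑ a, (p i a : 𝕜) • Z i a = 0)
    {t : ℝ} (ht : √(Fintype.card ι) * B ≤ t) :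
    ∑ x : ι → α with t ≤ ‖∑ i, Z i (x i)‖, ∏ i, p i (x i)
      ≤ Real.exp (-((t - √(Fintype.card ι) * B) ^ 2 / (8 * (Fintype.card ι * B ^ 2)))) := by
  have e := (Fintype.equivFin ι).symm
  have h := sum_prod_norm_ge_le_fin (𝕜 := 𝕜) hB Fintype.card_pos (fun i => p (e i))
    (fun i => hp0 _) (fun i => hp1 _) (fun i => Z (e i)) (fun i => hZ _) (fun i => hZ0 _) ht
  refine le_trans (le_of_eq ?_) h
  rw [Finset.sum_filter, Finset.sum_filter, ← (e.arrowCongr (Equiv.refl α)).sum_comp]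
  refine Finset.sum_congr rfl fun x _ => ?_
  simp only [Equiv.arrowCongr_apply, Function.comp, Equiv.refl_apply]
  rw [← e.prod_comp, ← e.sum_comp]
  simp

/-! ### Trace norm and Frobenius norm -/

open Matrix in
theorem traceNorm_conj_diagonal {ι : Type*} [Fintype ι] [DecidableEq ι]
    (U : Matrix.unitaryGroup ι ℂ) (a : ι → ℝ) :
    traceNorm ((U : Matrix ι ι ℂ) * diagonal (fun i => (a i : ℂ)) * star (U : Matrix ι ι ℂ))
      = ∑ i, |a i| := by
  set A := (U : Matrix ι ι ℂ) * diagonal (fun i => (a i : ℂ)) * star (U : Matrix ι ι ℂ) with hA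
  have hU : star (U : Matrix ι ι ℂ) * (U : Matrix ι ι ℂ) = 1 := Unitary.coe_star_mul_self U
  have hsq : Aᴴ * A = (U : Matrix ι ι ℂ) * diagonal (fun i => ((a i ^ 2 : ℝ) : ℂ))
      * star (U : Matrix ι ι ℂ) := by
    have hd : diagonal (fun i => ((a i ^ 2 : ℝ) : ℂ))
        = diagonal (fun i => (a i : ℂ)) * diagonal (fun i => (a i : ℂ)) := by
      rw [diagonal_mul_diagonal]; congr 1; ext i; push_cast; ring
    have hc : Aᴴ = A := by
      rw [hA, conjTranspose_mul, conjTranspose_mul, star_eq_conjTranspose,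
        conjTranspose_conjTranspose, diagonal_conjTranspose, Matrix.mul_assoc]
      congr 3
      ext i
      simp
    rw [hc, hd, hA]
    simp only [Matrix.mul_assoc]
    rw [← Matrix.mul_assoc (star (U : Matrix ι ι ℂ)) (U : Matrix ι ι ℂ), hU, Matrix.one_mul]
  -- Comparing the roots of the characteristic polynomial as multisets avoids matching the order of
  -- the eigenvalues with that of `a`.
  have h := (isHermitian_conjTranspose_mul_self A).roots_charpoly_eq_eigenvalues
  have hroots : (Aᴴ * A).charpoly.roots
      = Finset.univ.val.map (fun i => ((a i ^ 2 : ℝ) : ℂ)) := by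
    rw [hsq, Matrix.charpoly_mul_comm, ← Matrix.mul_assoc, hU, Matrix.one_mul, charpoly_diagonal,
      Polynomial.roots_prod _ _ (Finset.prod_ne_zero_iff.2 fun i _ => Polynomial.X_sub_C_ne_zero _)]
    simp only [Polynomial.roots_X_sub_C, Multiset.bind_singleton]
  rw [hroots] at h
  have h2 := congrArg (fun s : Multiset ℂ => (s.map fun z : ℂ => √z.re).sum) h
  simp only [Multiset.map_map, Function.comp_def] at h2
  simp only [Complex.ofReal_re, Complex.coe_algebraMap, Real.sqrt_sq_eq_abs] at h2
  exact h2.symm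

/-- The Frobenius space of square matrices. -/
noncomputable def toFrobenius {ι : Type*} (A : Matrix ι ι ℂ) : EuclideanSpace ℂ (ι × ι) :=
  WithLp.toLp 2 fun q => A q.1 q.2

theorem norm_sq_toFrobenius {ι : Type*} [Fintype ι] (A : Matrix ι ι ℂ) :
    ‖toFrobenius A‖ ^ 2 = ∑ s, ∑ t, ‖A s t‖ ^ 2 := by
  rw [EuclideanSpace.norm_sq_eq, Fintype.sum_prod_type]
  rfl

/-- Cauchy–Schwarz for the singular values, whose squares sum to `tr (Aᴴ A)`. -/
theorem traceNorm_le {ι : Type*} [Fintype ι] [DecidableEq ι] (A : Matrix ι ι ℂ) :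
    traceNorm A ≤ √(Fintype.card ι) * ‖toFrobenius A‖ := by
  set hH := Matrix.isHermitian_conjTranspose_mul_self A
  have hnn : ∀ i, 0 ≤ hH.eigenvalues i :=
    (Matrix.posSemidef_conjTranspose_mul_self A).eigenvalues_nonneg
  have htr : ∑ i, hH.eigenvalues i = ‖toFrobenius A‖ ^ 2 := by
    have h := congrArg Complex.re hH.trace_eq_sum_eigenvalues
    have hre : (∑ i, (hH.eigenvalues i : ℂ)).re = ∑ i, hH.eigenvalues i := by
      rw [← Complex.ofReal_sum, Complex.ofReal_re]
    rw [norm_sq_toFrobenius, Finset.sum_comm]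
    refine hre.symm.trans (h.symm.trans ?_)
    simp only [Matrix.trace, Matrix.diag, Matrix.mul_apply, Matrix.conjTranspose_apply,
      Complex.re_sum]
    refine Finset.sum_congr rfl fun i _ => Finset.sum_congr rfl fun j _ => ?_
    rw [← Complex.normSq_eq_norm_sq, Complex.normSq_apply]
    simp
  refine (le_abs_self _).trans (abs_le_of_sq_le_sq ?_ (by positivity))
  rw [mul_pow, Real.sq_sqrt (Nat.cast_nonneg _), ← htr]
  have := sq_sum_le_card_mul_sum_sq (s := Finset.univ) (f := fun i => √(hH.eigenvalues i))
  simp only [Real.sq_sqrt (hnn _), Finset.card_univ] at this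
  exact this

/-- The maximally mixed state. -/
noncomputable def maximallyMixed (n : ℕ) : DensityMatrix n where
  val := Matrix.diagonal fun _ => (((2 ^ n : ℝ)⁻¹ : ℝ) : ℂ)
  posSemidef := Matrix.PosSemidef.diagonal fun _ => by
    simp only [Pi.zero_apply]
    exact_mod_cast (by positivity : (0 : ℝ) ≤ (2 ^ n : ℝ)⁻¹)
  trace_eq_one := by simp [Matrix.trace]

-- Settles `ε > 2` without any measurement. The maximally mixed state is diagonal in every basis,
-- hence in an eigenbasis of `ρ`.
open Matrix in
theorem traceNorm_sub_maximallyMixed_le {n : ℕ} (ρ : DensityMatrix n) :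
    traceNorm (ρ.val - (maximallyMixed n).val) ≤ 2 := by
  set hH := ρ.posSemidef.isHermitian
  set U := hH.eigenvectorUnitary
  set d : ℝ := (2 ^ n : ℝ)⁻¹ with hd
  have hU : (U : Matrix (Bits n) (Bits n) ℂ) * star (U : Matrix (Bits n) (Bits n) ℂ) = 1 := Unitary.coe_mul_star_self U
  have h1 : ρ.val = (U : Matrix (Bits n) (Bits n) ℂ) * diagonal (fun i => (hH.eigenvalues i : ℂ))
      * star (U : Matrix (Bits n) (Bits n) ℂ) := by
    conv_lhs => rw [hH.spectral_theorem, Unitary.conjStarAlgAut_apply]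
    rfl
  have h2 : (maximallyMixed n).val = (U : Matrix (Bits n) (Bits n) ℂ) * diagonal (fun _ => (d : ℂ))
      * star (U : Matrix (Bits n) (Bits n) ℂ) := by
    have : diagonal (fun _ : Bits n => (d : ℂ)) = (d : ℂ) • 1 := by
      rw [smul_one_eq_diagonal]
    rw [this, Matrix.mul_smul, Matrix.smul_mul, Matrix.mul_one, hU, ← this]
    rfl
  have h3 : ρ.val - (maximallyMixed n).val = (U : Matrix (Bits n) (Bits n) ℂ)
      * diagonal (fun i => ((hH.eigenvalues i - d : ℝ) : ℂ)) * star (U : Matrix (Bits n) (Bits n) ℂ) := by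
    refine (congrArg₂ (· - ·) h1 h2).trans ?_
    simp only [← Matrix.sub_mul, ← Matrix.mul_sub, diagonal_sub, Complex.ofReal_sub]
  rw [h3, traceNorm_conj_diagonal]
  have htr : ∑ i, hH.eigenvalues i = 1 := by
    have h : (1 : ℂ) = ∑ i, (hH.eigenvalues i : ℂ) :=
      ρ.trace_eq_one.symm.trans hH.trace_eq_sum_eigenvalues
    exact_mod_cast h.symm
  calc ∑ i, |hH.eigenvalues i - d| ≤ ∑ i, (hH.eigenvalues i + d) := by
        refine Finset.sum_le_sum fun i _ => (abs_sub _ _).trans ?_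
        rw [abs_of_nonneg (ρ.posSemidef.eigenvalues_nonneg i), abs_of_nonneg (by positivity)]
    _ = 2 := by
        rw [Finset.sum_add_distrib, htr]
        simp [hd]; norm_num

/-! ### The estimator as a sum of independent product operators -/

/-- The single-qubit factor of the contribution of one outcome. -/
noncomputable def qubitSnapshot (a : PauliAxis) (b : Fin 2) : Matrix (Fin 2) (Fin 2) ℂ :=
  (1 / 6 : ℂ) • 1 + ((sign b : ℂ) / 2) • a.toMatrix

/-- The contribution of the outcome string `s` of the setting `P` to the estimator, up to a
normalization by the number of copies for each setting. -/
noncomputable def snapshot {n : ℕ} (P : Fin n → PauliAxis) (s : Bits n) :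
    Matrix (Bits n) (Bits n) ℂ :=
  tensor fun i => qubitSnapshot (P i) (s i)

/-- The matrices `I` and `σ_a` are orthogonal with squared norm 2, so the value is `2/36 + 2/4`. -/
theorem sum_norm_sq_qubitSnapshot (a : PauliAxis) (b : Fin 2) :
    ∑ u, ∑ v, ‖qubitSnapshot a b u v‖ ^ 2 = 5 / 9 := by
  simp only [← Complex.normSq_eq_norm_sq, Complex.normSq_apply]
  cases a <;> fin_cases b <;>
    simp [qubitSnapshot, sign, PauliAxis.toMatrix, Fin.sum_univ_two] <;> norm_num

theorem norm_sq_snapshot {n : ℕ} (P : Fin n → PauliAxis) (s : Bits n) :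
    ‖toFrobenius (snapshot P s)‖ ^ 2 = (5 / 9) ^ n := by
  rw [norm_sq_toFrobenius]
  have h : ∀ u v, ‖snapshot P s u v‖ ^ 2 = ∏ i, ‖qubitSnapshot (P i) (s i) (u i) (v i)‖ ^ 2 := by
    intro u v
    simp [snapshot, tensor, norm_prod, Finset.prod_pow]
  simp only [h]
  have h2 : ∀ u : Bits n, ∑ v : Bits n, ∏ i, ‖qubitSnapshot (P i) (s i) (u i) (v i)‖ ^ 2
      = ∏ i, ∑ b, ‖qubitSnapshot (P i) (s i) (u i) b‖ ^ 2 := by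
    intro u
    rw [← Fintype.piFinset_univ, ← Finset.prod_univ_sum (fun _ => Finset.univ)
      (fun i b => ‖qubitSnapshot (P i) (s i) (u i) b‖ ^ 2)]
  simp only [h2]
  rw [← Fintype.piFinset_univ, ← Finset.prod_univ_sum (fun _ => Finset.univ)
    (fun i a => ∑ b, ‖qubitSnapshot (P i) (s i) a b‖ ^ 2)]
  simp only [sum_norm_sq_qubitSnapshot, Finset.prod_const, Finset.card_univ, Fintype.card_fin]

/-- Summing over the outcome leaves `(I ⊗ I)/6 + (σ_a ⊗ σ_a)/2`; summing over the three axes gives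
half of `I ⊗ I + ∑ σ_a ⊗ σ_a`, which is the swap operator. This fixes the coefficient `1/6` in the
snapshot. -/
theorem sum_qubitProj_mul_qubitSnapshot (x y u v : Fin 2) :
    ∑ a, ∑ b, qubitProj a b y x * qubitSnapshot a b u v
      = if x = u ∧ y = v then 1 else 0 := by
  have hs : ∀ f : PauliAxis → ℂ, ∑ a, f a = f .X + f .Y + f .Z := by
    intro f
    have : (Finset.univ : Finset PauliAxis) = {.X, .Y, .Z} := rfl
    rw [this, Finset.sum_insert (by decide), Finset.sum_insert (by decide),
      Finset.sum_singleton]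
    ring
  rw [hs]
  fin_cases x <;> fin_cases y <;> fin_cases u <;> fin_cases v <;>
    simp [qubitSnapshot, qubitProj, sign, PauliAxis.toMatrix, Fin.sum_univ_two] <;>
    ring_nf <;> simp <;> norm_num

theorem sum_outcomeProj_mul_snapshot {n : ℕ} (x y u v : Bits n) :
    ∑ P, ∑ s, outcomeProj P s y x * snapshot P s u v = if x = u ∧ y = v then 1 else 0 := by
  have h1 : ∀ P : Fin n → PauliAxis, ∑ s, outcomeProj P s y x * snapshot P s u v
      = ∏ i, ∑ b, qubitProj (P i) b (y i) (x i) * qubitSnapshot (P i) b (u i) (v i) := by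
    intro P
    rw [Finset.prod_univ_sum, Fintype.piFinset_univ]
    simp [outcomeProj, snapshot, tensor, Finset.prod_mul_distrib]
  simp only [h1]
  rw [← Fintype.piFinset_univ, ← Finset.prod_univ_sum (fun _ => Finset.univ) (fun i a =>
    ∑ b, qubitProj a b (y i) (x i) * qubitSnapshot a b (u i) (v i))]
  simp only [sum_qubitProj_mul_qubitSnapshot, Finset.prod_ite_zero, Finset.prod_const_one,
    Finset.mem_univ, true_implies, funext_iff, forall_and]

theorem outcomeProj_conjTranspose {n : ℕ} (P : Fin n → PauliAxis) (s : Bits n) :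
    (outcomeProj P s).conjTranspose = outcomeProj P s := by
  simp only [outcomeProj, tensor_conjTranspose, qubitProj_conjTranspose]

theorem ofReal_bornProb {n : ℕ} (ρ : DensityMatrix n) (P : Fin n → PauliAxis) (s : Bits n) :
    (bornProb ρ P s : ℂ) = (ρ.val * outcomeProj P s).trace := by
  rw [bornProb]
  refine Complex.conj_eq_iff_re.1 ?_
  have h : star (ρ.val * outcomeProj P s).trace = (ρ.val * outcomeProj P s).trace := by
    rw [← Matrix.trace_conjTranspose, Matrix.conjTranspose_mul, outcomeProj_conjTranspose,
      ρ.posSemidef.isHermitian.eq, Matrix.trace_mul_comm]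
  exact h

/-- The snapshots, averaged over the outcomes and summed over the settings, recover the state. -/
theorem sum_bornProb_mul_snapshot {n : ℕ} (ρ : DensityMatrix n) (u v : Bits n) :
    ∑ P, ∑ s, (bornProb ρ P s : ℂ) * snapshot P s u v = ρ.val u v := by
  have h : ∀ P s, (bornProb ρ P s : ℂ) * snapshot P s u v
      = ∑ x, ∑ y, ρ.val x y * (outcomeProj P s y x * snapshot P s u v) := by
    intro P s
    rw [ofReal_bornProb]
    simp only [Matrix.trace, Matrix.diag, Matrix.mul_apply, Finset.sum_mul, mul_assoc]
  simp only [h]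
  calc _ = ∑ x, ∑ y, ρ.val x y * ∑ P, ∑ s, outcomeProj P s y x * snapshot P s u v := by
        simp only [Finset.mul_sum]
        rw [Finset.sum_congr rfl fun P _ => Finset.sum_comm, Finset.sum_comm]
        refine Finset.sum_congr rfl fun x _ => ?_
        rw [Finset.sum_congr rfl fun P _ => Finset.sum_comm, Finset.sum_comm]
    _ = _ := by
        simp only [sum_outcomeProj_mul_snapshot]
        rw [Finset.sum_eq_single u, Finset.sum_eq_single v] <;> simp +contextual

/-- The coefficient of the Pauli matrix `q` in `qubitSnapshot a b`. -/
noncomputable def qubitCoeff (a : PauliAxis) (b : Fin 2) : Option PauliAxis → ℂ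
  | none => 1 / 6
  | some c => if c = a then (sign b : ℂ) / 2 else 0

theorem qubitSnapshot_eq_sum (a : PauliAxis) (b u v : Fin 2) :
    qubitSnapshot a b u v = ∑ q, qubitCoeff a b q * pauliMatrix q u v := by
  rw [Fintype.sum_option]
  simp [qubitSnapshot, qubitCoeff, pauliMatrix]

/-- Each qubit contributes a factor `1/2`, each identity position a further `1/3`, and a Pauli
factor that disagrees with `P` kills the product. -/
theorem prod_qubitCoeff {n : ℕ} (P : Fin n → PauliAxis) (s : Bits n)
    (Q : Fin n → Option PauliAxis) :
    ∏ i, qubitCoeff (P i) (s i) (Q i) = if Corresponds Q P then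
      ((∏ i with Q i ≠ none, sign (s i) : ℤ) : ℂ) / (3 ^ (n - weight Q) * 2 ^ n) else 0 := by
  have h : ∀ i, qubitCoeff (P i) (s i) (Q i) = if Q i = none ∨ Q i = some (P i) then
      ((if Q i ≠ none then sign (s i) else 1 : ℤ) : ℂ) / ((if Q i = none then 3 else 1) * 2)
      else 0 := by
    intro i
    cases hq : Q i with
    | none => simp [qubitCoeff]; norm_num
    | some c => by_cases hc : c = P i <;> simp [qubitCoeff, hc]
  have h3 : ∏ i, (if Q i = none then (3 : ℂ) else 1) = 3 ^ (n - weight Q) := by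
    rw [← Finset.prod_filter, Finset.prod_const]
    congr 1
    have := Finset.card_filter_add_card_filter_not (s := (Finset.univ : Finset (Fin n)))
      (fun i => Q i = none)
    simp only [Finset.card_univ, Fintype.card_fin] at this
    simp only [weight, ne_eq]
    omega
  simp only [h]
  rw [Finset.prod_ite_zero]
  simp only [Finset.mem_univ, true_implies, Corresponds]
  refine if_congr Iff.rfl ?_ rfl
  rw [Finset.prod_div_distrib, Finset.prod_mul_distrib, h3, Finset.prod_filter]
  simp

theorem snapshot_eq_sum {n : ℕ} (P : Fin n → PauliAxis) (s u v : Bits n) :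
    snapshot P s u v = ∑ Q : Fin n → Option PauliAxis, if Corresponds Q P then
      ((∏ i with Q i ≠ none, sign (s i) : ℤ) : ℂ) / (3 ^ (n - weight Q) * 2 ^ n)
        * tensor (fun i => pauliMatrix (Q i)) u v else 0 := by
  simp only [snapshot, tensor, Matrix.of_apply, qubitSnapshot_eq_sum]
  rw [Finset.prod_univ_sum, Fintype.piFinset_univ]
  refine Finset.sum_congr rfl fun Q _ => ?_
  rw [Finset.prod_mul_distrib, prod_qubitCoeff, ite_mul, zero_mul]

/-- Exchanging the sums over Pauli operators and copies exhibits the estimator as a sum of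
independent terms. -/
theorem pauliEstimator_apply {n m : ℕ} (x : Record n m) (u v : Bits n) :
    pauliEstimator x u v = ∑ c : Copy n m, (m : ℂ)⁻¹ * snapshot c.1 (x c) u v := by
  rw [Fintype.sum_prod_type]
  simp only [snapshot_eq_sum, Finset.mul_sum]
  rw [Finset.sum_congr rfl fun P _ => Finset.sum_comm, Finset.sum_comm]
  rw [pauliEstimator, Matrix.sum_apply]
  refine Finset.sum_congr rfl fun Q _ => ?_
  rw [Matrix.smul_apply, smul_eq_mul, sampleSum, Finset.sum_filter]
  push_cast
  rw [Finset.sum_div, Finset.sum_mul]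
  refine Finset.sum_congr rfl fun P _ => ?_
  split_ifs
  · rw [Finset.sum_div, Finset.sum_mul]
    refine Finset.sum_congr rfl fun j _ => ?_
    field_simp
  · simp

/-! ### The law of the record and unbiasedness -/

instance {n : ℕ} (ρ : DensityMatrix n) (m : ℕ) : IsProbabilityMeasure (recordLaw ρ m) := by
  unfold recordLaw; infer_instance

theorem outcomePMF_toMeasure_real_singleton {n : ℕ} (ρ : DensityMatrix n) (P : Fin n → PauliAxis)
    (s : Bits n) : (outcomePMF ρ P).toMeasure.real {s} = bornProb ρ P s := by
  rw [Measure.real, PMF.toMeasure_apply_singleton _ _ (measurableSet_singleton _), outcomePMF,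
    PMF.ofFintype_apply, ENNReal.toReal_ofReal (bornProb_nonneg ρ P s)]

theorem recordLaw_real_singleton {n m : ℕ} (ρ : DensityMatrix n) (x : Record n m) :
    (recordLaw ρ m).real {x} = ∏ c : Copy n m, bornProb ρ c.1 (x c) := by
  rw [Measure.real, recordLaw, Measure.pi_singleton, ENNReal.toReal_prod]
  exact Finset.prod_congr rfl fun c _ => outcomePMF_toMeasure_real_singleton ρ c.1 (x c)

theorem recordLaw_real_eq_sum {n m : ℕ} (ρ : DensityMatrix n) (p : Record n m → Prop)
    [DecidablePred p] :
    (recordLaw ρ m).real {x | p x} = ∑ x with p x, ∏ c : Copy n m, bornProb ρ c.1 (x c) := by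
  have : {x | p x} = ((Finset.univ.filter p : Finset (Record n m)) : Set (Record n m)) := by
    ext x; simp
  rw [this, ← sum_measureReal_singleton]
  exact Finset.sum_congr rfl fun x _ => recordLaw_real_singleton ρ x

/-- The estimator is unbiased. -/
theorem integral_pauliEstimator {n m : ℕ} (hm : 0 < m) (ρ : DensityMatrix n) (u v : Bits n) :
    ∫ x, pauliEstimator x u v ∂(recordLaw ρ m) = ρ.val u v := by
  simp only [pauliEstimator_apply]
  rw [integral_finsetSum _ fun c _ => Integrable.of_finite]
  have h : ∀ c : Copy n m, ∫ x, (m : ℂ)⁻¹ * snapshot c.1 (x c) u v ∂(recordLaw ρ m)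
      = (m : ℂ)⁻¹ * ∑ s, (bornProb ρ c.1 s : ℂ) * snapshot c.1 s u v := by
    intro c
    rw [integral_const_mul]
    congr 1
    have := integral_comp_eval (μ := fun c : Copy n m => (outcomePMF ρ c.1).toMeasure) (i := c)
      (f := fun s => snapshot c.1 s u v) (Integrable.of_finite).aestronglyMeasurable
    refine this.trans ?_
    rw [integral_fintype Integrable.of_finite]
    refine Finset.sum_congr rfl fun s _ => ?_
    rw [outcomePMF_toMeasure_real_singleton, Complex.real_smul]
  simp only [h]
  rw [Fintype.sum_prod_type]
  simp only [Finset.sum_const, Finset.card_univ, Fintype.card_fin, nsmul_eq_mul]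
  rw [← sum_bornProb_mul_snapshot ρ u v]
  refine Finset.sum_congr rfl fun P _ => ?_
  have : (m : ℂ) ≠ 0 := by exact_mod_cast hm.ne'
  field_simp

/-! ### Concentration of the estimator -/

/-- The centred contribution of one copy to the estimator. -/
noncomputable def deviation {n : ℕ} (ρ : DensityMatrix n) (m : ℕ) (P : Fin n → PauliAxis)
    (s : Bits n) : EuclideanSpace ℂ (Bits n × Bits n) :=
  (m : ℂ)⁻¹ • (toFrobenius (snapshot P s)
    - ∑ r, (bornProb ρ P r : ℂ) • toFrobenius (snapshot P r))

theorem sum_bornProb_smul_deviation {n : ℕ} (ρ : DensityMatrix n) (m : ℕ)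
    (P : Fin n → PauliAxis) : ∑ s, (bornProb ρ P s : ℂ) • deviation ρ m P s = 0 := by
  have h1 : ∑ s, (bornProb ρ P s : ℂ) = 1 := by exact_mod_cast bornProb_sum ρ P
  simp only [deviation, smul_comm _ ((m : ℂ)⁻¹)]
  rw [← Finset.smul_sum]
  simp only [smul_sub, Finset.sum_sub_distrib]
  rw [← Finset.sum_smul, h1, one_smul, sub_self]

theorem norm_deviation_le {n : ℕ} (ρ : DensityMatrix n) (m : ℕ) (P : Fin n → PauliAxis)
    (s : Bits n) : ‖deviation ρ m P s‖ ≤ 2 * √((5 / 9) ^ n) / m := by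
  have hs : ∀ r, ‖toFrobenius (snapshot P r)‖ = √((5 / 9) ^ n) := by
    intro r
    rw [← norm_sq_snapshot P r, Real.sqrt_sq (norm_nonneg _)]
  have hmean : ‖∑ r, (bornProb ρ P r : ℂ) • toFrobenius (snapshot P r)‖ ≤ √((5 / 9) ^ n) := by
    refine (norm_sum_le _ _).trans (le_of_eq ?_)
    simp only [norm_smul, hs, Complex.norm_real, Real.norm_of_nonneg (bornProb_nonneg ρ P _)]
    rw [← Finset.sum_mul, bornProb_sum, one_mul]
  rw [deviation, norm_smul, norm_inv, Complex.norm_natCast, div_eq_inv_mul]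
  refine mul_le_mul_of_nonneg_left ?_ (by positivity)
  refine (norm_sub_le _ _).trans ?_
  rw [hs]; linarith

theorem sum_deviation {n m : ℕ} (hm : 0 < m) (ρ : DensityMatrix n) (x : Record n m) :
    ∑ c : Copy n m, deviation ρ m c.1 (x c) = toFrobenius (pauliEstimator x - ρ.val) := by
  have hm' : (m : ℂ) ≠ 0 := by exact_mod_cast hm.ne'
  ext q
  simp only [deviation, toFrobenius, WithLp.ofLp_sum, Finset.sum_apply, PiLp.smul_apply,
    PiLp.sub_apply, smul_eq_mul, Matrix.sub_apply, pauliEstimator_apply, mul_sub,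
    Finset.sum_sub_distrib]
  congr 1
  rw [Fintype.sum_prod_type, ← sum_bornProb_mul_snapshot]
  refine Finset.sum_congr rfl fun P _ => ?_
  simp [hm']

theorem card_copy (n m : ℕ) : Fintype.card (Copy n m) = 3 ^ n * m := by
  have : Fintype.card PauliAxis = 3 := rfl
  simp [this]

/-- Concentration of the estimator in Frobenius norm. -/
theorem recordLaw_norm_ge_le {n m : ℕ} (hm : 0 < m) (ρ : DensityMatrix n) {t : ℝ}
    (ht : 2 * √((5 / 3) ^ n / m) ≤ t) :
    (recordLaw ρ m).real {x | t ≤ ‖toFrobenius (pauliEstimator x - ρ.val)‖}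
      ≤ Real.exp (-((t - 2 * √((5 / 3) ^ n / m)) ^ 2 / (32 * ((5 / 3) ^ n / m)))) := by
  have hm' : (0 : ℝ) < m := by exact_mod_cast hm
  have : Nonempty (Copy n m) := ⟨(fun _ => .X, ⟨0, hm⟩)⟩
  -- The variance proxy `N B²`: the `3^n` settings turn `(5/9)^n` into `(5/3)^n`, and the 4 comes
  -- from centring.
  have hsq : (Fintype.card (Copy n m) : ℝ) * (2 * √((5 / 9) ^ n) / m) ^ 2
      = 4 * ((5 / 3) ^ n / m) := by
    rw [card_copy, div_pow, mul_pow, Real.sq_sqrt (by positivity)]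
    have : (5 / 3 : ℝ) ^ n = 3 ^ n * (5 / 9) ^ n := by rw [← mul_pow]; norm_num
    rw [this]; push_cast; field_simp; norm_num
  have hrt : √(Fintype.card (Copy n m) : ℝ) * (2 * √((5 / 9) ^ n) / m)
      = 2 * √((5 / 3) ^ n / m) := by
    rw [← Real.sqrt_sq (by positivity : 0 ≤ 2 * √((5 / 9 : ℝ) ^ n) / m),
      ← Real.sqrt_mul (Nat.cast_nonneg _), hsq, Real.sqrt_mul (by norm_num)]
    congr 1
    rw [show (4 : ℝ) = 2 ^ 2 by norm_num, Real.sqrt_sq (by norm_num)]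
  have h := sum_prod_norm_ge_le (𝕜 := ℂ) (B := 2 * √((5 / 9) ^ n) / m) (t := t) (by positivity)
    (fun c : Copy n m => bornProb ρ c.1) (fun c => bornProb_nonneg ρ c.1)
    (fun c => bornProb_sum ρ c.1) (fun c => deviation ρ m c.1)
    (fun c => norm_deviation_le ρ m c.1) (fun c => sum_bornProb_smul_deviation ρ m c.1)
    (by rwa [hrt])
  rw [hrt, hsq] at h
  simp only [sum_deviation hm] at h
  classical
  rw [recordLaw_real_eq_sum]
  convert h using 3
  ring

theorem toFrobenius_sub_comm {ι : Type*} [Fintype ι] (A B : Matrix ι ι ℂ) :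
    ‖toFrobenius (A - B)‖ = ‖toFrobenius (B - A)‖ := by
  rw [show toFrobenius (A - B) = -toFrobenius (B - A) by ext q; simp [toFrobenius], norm_neg]

theorem norm_toFrobenius_sub_le {ι : Type*} [Fintype ι] (A B C : Matrix ι ι ℂ) :
    ‖toFrobenius (A - C)‖ ≤ ‖toFrobenius (A - B)‖ + ‖toFrobenius (B - C)‖ := by
  rw [show toFrobenius (A - C) = toFrobenius (A - B) + toFrobenius (B - C) by
    ext q; simp [toFrobenius]]
  exact norm_add_le _ _

/-- With enough copies, the estimator is close to the state in Frobenius norm with high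
probability. -/
theorem one_sub_le_recordLaw_real {n m : ℕ} (hm : 0 < m) {ε δ : ℝ} (hε : 0 < ε) (hδ : 0 < δ)
    (h1 : 64 * (10 / 3) ^ n ≤ m * ε ^ 2)
    (h2 : 512 * (10 / 3) ^ n * Real.log (1 / δ) ≤ m * ε ^ 2) (ρ : DensityMatrix n) :
    1 - δ ≤ (recordLaw ρ m).real
      {x | ‖toFrobenius (ρ.val - pauliEstimator x)‖ < ε / 2 / √(2 ^ n)} := by
  have hm' : (0 : ℝ) < m := by exact_mod_cast hm
  set W : ℝ := (5 / 3) ^ n / m with hW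
  set t : ℝ := ε / 2 / √(2 ^ n) with ht
  have hWpos : 0 < W := by positivity
  have ht0 : 0 < t := by positivity
  have h103 : (10 / 3 : ℝ) ^ n = 2 ^ n * W * m := by
    rw [hW, mul_assoc, div_mul_cancel₀ _ hm'.ne', ← mul_pow]; norm_num
  have htsq : ε ^ 2 = 4 * 2 ^ n * t ^ 2 := by
    rw [ht, div_pow, Real.sq_sqrt (by positivity)]; field_simp; norm_num
  have hpos : (0 : ℝ) < 4 * 2 ^ n * m := by positivity
  have ht1 : 16 * W ≤ t ^ 2 := by
    rw [h103, htsq] at h1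
    exact le_of_mul_le_mul_left (by linarith) hpos
  have ht2 : 128 * W * Real.log (1 / δ) ≤ t ^ 2 := by
    rw [h103, htsq] at h2
    exact le_of_mul_le_mul_left (by linarith) hpos
  -- Hence `t - 2√W ≥ t/2`, and the tail exponent is at least `t² / (128 W)`, which `ht2` compares
  -- with `log (1/δ)`.
  have hrt : 4 * √W ≤ t := by
    refine (le_abs_self _).trans (abs_le_of_sq_le_sq ?_ ht0.le)
    rw [mul_pow, Real.sq_sqrt hWpos.le]; linarith
  have hs0 := Real.sqrt_nonneg W
  have htail := recordLaw_norm_ge_le hm ρ (t := t) (by rw [← hW]; linarith)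
  rw [← hW] at htail
  have hexp : Real.exp (-((t - 2 * √W) ^ 2 / (32 * W))) ≤ δ := by
    rw [← Real.le_log_iff_exp_le hδ, neg_le, ← Real.log_inv, ← one_div,
      le_div_iff₀ (by positivity)]
    nlinarith
  have hcompl : {x : Record n m | ‖toFrobenius (ρ.val - pauliEstimator x)‖ < t}
      = {x | t ≤ ‖toFrobenius (pauliEstimator x - ρ.val)‖}ᶜ := by
    ext x; simp [toFrobenius_sub_comm ρ.val]
  rw [hcompl, probReal_compl_eq_one_sub (Set.toFinite _).measurableSet]
  linarith

theorem traceNorm_lt {n : ℕ} {A : Matrix (Bits n) (Bits n) ℂ} {r : ℝ}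
    (h : ‖toFrobenius A‖ < r / √(2 ^ n)) : traceNorm A < r := by
  refine (traceNorm_le A).trans_lt ?_
  rw [lt_div_iff₀ (by positivity)] at h
  simpa [mul_comm] using h

/-! ### Passing from the estimator to a state -/

/-- A density matrix within Frobenius distance `r` of the estimator, if there is one. -/
noncomputable def nearbyState {n m : ℕ} (r : ℝ) (x : Record n m) : DensityMatrix n :=
  open Classical in
  if h : ∃ τ : DensityMatrix n, ‖toFrobenius (τ.val - pauliEstimator x)‖ < r then h.choose
  else maximallyMixed n

theorem norm_sub_nearbyState_lt {n m : ℕ} {r : ℝ} {x : Record n m} {ρ : DensityMatrix n}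
    (h : ‖toFrobenius (ρ.val - pauliEstimator x)‖ < r) :
    ‖toFrobenius (ρ.val - (nearbyState r x).val)‖ < 2 * r := by
  have hex : ∃ τ : DensityMatrix n, ‖toFrobenius (τ.val - pauliEstimator x)‖ < r := ⟨ρ, h⟩
  have h2 : ‖toFrobenius ((nearbyState r x).val - pauliEstimator x)‖ < r := by
    rw [nearbyState, dif_pos hex]; exact hex.choose_spec
  have h3 := norm_toFrobenius_sub_le ρ.val (pauliEstimator x) (nearbyState r x).val
  rw [toFrobenius_sub_comm (pauliEstimator x)] at h3
  linarith

end PauliTomography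

/-! ### Choice of the number of copies -/

theorem theorem1 (δ₀ : ℝ) (hδ₀ : δ₀ < 1) :
    ∃ C : ℝ, 0 < C ∧ ∀ (n : ℕ) (ε δ : ℝ), 0 < ε → 0 < δ → δ ≤ δ₀ →
      ∃ m : ℕ,
        (Fintype.card (Copy n m) : ℝ) ≤ C * (10 ^ n * Real.log (1 / δ) / ε ^ 2) ∧
        (∃ σ : Record n m → DensityMatrix n, ∀ ρ : DensityMatrix n,
          1 - δ ≤ (recordLaw ρ m).real {x | traceNorm (ρ.val - (σ x).val) < ε}) ∧
        (ε ≤ 2 → 0 < m ∧ ∀ ρ : DensityMatrix n,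
          (∀ s t, ∫ x, pauliEstimator x s t ∂(recordLaw ρ m) = ρ.val s t) ∧
          1 - δ ≤ (recordLaw ρ m).real {x | traceNorm (ρ.val - pauliEstimator x) < ε}) := by
  rcases le_or_gt δ₀ 0 with h0 | h0
  · exact ⟨1, one_pos, fun n ε δ _ hδ hle => absurd (hδ.trans_le hle) (not_lt.2 h0)⟩
  set L₀ : ℝ := Real.log (1 / δ₀) with hL₀
  have hL₀pos : 0 < L₀ := Real.log_pos (by rw [lt_div_iff₀ h0]; linarith)
  -- The 512 pays for the tail. The term `64 / L₀` pays for the mean of the error, which carries no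
  -- logarithm; `δ ≤ δ₀` gives `L / L₀ ≥ 1`.
  set K : ℝ := 512 + 64 / L₀ with hK
  have hKpos : 0 < K := by positivity
  -- The extra `4 / L₀` absorbs the rounding of `K * R` up to an integer.
  refine ⟨K + 4 / L₀, by positivity, fun n ε δ hε hδ hle => ?_⟩
  set L : ℝ := Real.log (1 / δ) with hL
  have hLL : L₀ ≤ L := Real.log_le_log (by positivity) (one_div_le_one_div_of_le hδ hle)
  have hLpos : 0 < L := hL₀pos.trans_le hLL
  rcases lt_or_ge 2 ε with h2 | h2
  · refine ⟨0, ?_, ⟨fun _ => maximallyMixed n, fun ρ => ?_⟩, fun h => absurd h2 (not_lt.2 h)⟩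
    · rw [card_copy]
      simp only [mul_zero, Nat.cast_zero]
      positivity
    · have : {x : Record n 0 | traceNorm (ρ.val - (maximallyMixed n).val) < ε} = Set.univ :=
        Set.eq_univ_of_forall fun _ => (traceNorm_sub_maximallyMixed_le ρ).trans_lt h2
      rw [this, probReal_univ]
      linarith
  set R : ℝ := (10 / 3) ^ n * L / ε ^ 2 with hR
  have hRpos : 0 < R := by positivity
  have hm : 0 < ⌈K * R⌉₊ := Nat.ceil_pos.2 (by positivity)
  have hge : K * R ≤ ⌈K * R⌉₊ := Nat.le_ceil _
  have hlt : (⌈K * R⌉₊ : ℝ) < K * R + 1 := Nat.ceil_lt_add_one (by positivity)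
  generalize ⌈K * R⌉₊ = m at hm hge hlt
  have hm' : (0 : ℝ) < m := by exact_mod_cast hm
  have hKR : K * ((10 / 3) ^ n * L) ≤ m * ε ^ 2 := by
    rw [hR, ← mul_div_assoc, div_le_iff₀ (by positivity)] at hge
    exact hge
  have hpow : (0 : ℝ) < (10 / 3) ^ n := by positivity
  have hratio : 1 ≤ L / L₀ := (one_le_div hL₀pos).2 hLL
  have hsplit : K * ((10 / 3) ^ n * L)
      = 512 * (10 / 3) ^ n * L + 64 * (10 / 3) ^ n * (L / L₀) := by
    rw [hK]; field_simp
  have hb1 : 64 * (10 / 3) ^ n ≤ m * ε ^ 2 := by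
    have : 64 * (10 / 3 : ℝ) ^ n ≤ 64 * (10 / 3) ^ n * (L / L₀) :=
      le_mul_of_one_le_right (by positivity) hratio
    have : 0 < 512 * (10 / 3) ^ n * L := by positivity
    linarith
  have hb2 : 512 * (10 / 3) ^ n * L ≤ m * ε ^ 2 := by
    have : 0 < 64 * (10 / 3) ^ n * (L / L₀) := by positivity
    linarith
  have hconc := one_sub_le_recordLaw_real hm hε hδ hb1 hb2
  refine ⟨m, ?_, ⟨nearbyState (ε / 2 / √(2 ^ n)), fun ρ => ?_⟩, fun _ => ⟨hm, fun ρ =>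
    ⟨integral_pauliEstimator hm ρ, ?_⟩⟩⟩
  -- Here `ε ≤ 2` is essential: for large `ε` the budget may be smaller than one copy per setting.
  · have hone : 1 ≤ 4 / L₀ * R := by
      have h10 : (1 : ℝ) ≤ (10 / 3) ^ n := one_le_pow₀ (by norm_num)
      have hε4 : ε ^ 2 ≤ 4 := by nlinarith
      have : 4 / L₀ * R = 4 / ε ^ 2 * (L / L₀) * (10 / 3) ^ n := by rw [hR]; field_simp
      rw [this]
      have h4 : 1 ≤ 4 / ε ^ 2 := (one_le_div (by positivity)).2 hε4
      exact one_le_mul_of_one_le_of_one_le (one_le_mul_of_one_le_of_one_le h4 hratio) h10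
    have h3 : (10 : ℝ) ^ n * L / ε ^ 2 = 3 ^ n * R := by
      rw [hR, mul_div_assoc', ← mul_assoc, ← mul_pow]; norm_num
    rw [card_copy, h3]
    push_cast
    have : (m : ℝ) ≤ (K + 4 / L₀) * R := by rw [add_mul]; linarith
    calc (3 : ℝ) ^ n * m ≤ 3 ^ n * ((K + 4 / L₀) * R) :=
          mul_le_mul_of_nonneg_left this (by positivity)
      _ = _ := by ring
  · refine (hconc ρ).trans (measureReal_mono fun x hx => traceNorm_lt ?_)
    have := norm_sub_nearbyState_lt hx
    rwa [show 2 * (ε / 2 / √(2 ^ n)) = ε / √(2 ^ n) by ring] at this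
  · refine (hconc ρ).trans (measureReal_mono fun x hx => ?_)
    have := traceNorm_lt hx
    exact this.trans (by linarith)
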